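/- Let $k$ be an algebraically closed field of characteristic zero and let $X$ be a smooth projective (integral) curve over $k$ with canonical line bundle $K_X$. A presentation of a line bundle $\mathcal L$ on $X$ is an isomorphism $\mathcal L\simeq K_X(-D+E)$, where $D\ge 0$ and $E>0$ are divisors on $X$ with $h^0(X,\mathcal O_X(D))=1$ and $\gcd(D,E)=0$ (here the greatest common divisor $(A,B)$ of two divisors is their pointwise minimum). The presentation is minimal if $\deg F\ge\deg E$ for every presentation $\mathcal L\simeq K_X(-D'+F)$ of $\mathcal L$. Let $\phi:X\to\mathbb P^1$ be an $n$-fold covering, i.e. a finite surjective $k$-morphism of degree $n$. If $\mathcal L\simeq K_X(-D+E)$ is a minimal presentation of a line bundle $\mathcal L$ on $X$, then $$\deg\big(D,\phi^*(P)\big)+\deg\big(E,\phi^*(Q)\big)\le n\qquad\text{for all points }P,Q\in\mathbb P^1.$$ -/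

import Mathlib

open CategoryTheory AlgebraicGeometry TensorProduct
universe u

noncomputable section

/-- The localization at a prime of a standard smooth algebra of relative dimension one is a discrete
valuation ring, when its residue field is the base ring. -/
theorem isDVR_of_smooth {A B R : Type u} [CommRing A] [CommRing B] [CommRing R]
    [Algebra A B] [Algebra B R] [Algebra A R] [IsScalarTower A B R]
    [Algebra.IsStandardSmoothOfRelativeDimension 1 A B]
    (p : Ideal B) [p.IsPrime] [IsLocalization.AtPrime R p]
    [IsLocalRing R] [IsNoetherianRing R] [IsDomain R]
    (h : Function.Bijective (algebraMap A (IsLocalRing.ResidueField R))) :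
    IsDiscreteValuationRing R := by
  have : Nontrivial B := ⟨0, 1, fun h => by
    have := congrArg (algebraMap B R) h; simp at this⟩
  have : Algebra.IsStandardSmooth A B :=
    Algebra.IsStandardSmoothOfRelativeDimension.isStandardSmooth 1
  have : Algebra.FormallyEtale B R := Algebra.FormallyEtale.of_isLocalization p.primeCompl
  have : Algebra.FormallySmooth A B := inferInstance
  have : Algebra.FormallySmooth A R := Algebra.FormallySmooth.comp A B R
  let e := KaehlerDifferential.tensorKaehlerEquivOfFormallyEtale A B R
  have hB : Module.rank B (Ω[B⁄A]) = 1 := by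
    simpa using Algebra.IsStandardSmoothOfRelativeDimension.rank_kaehlerDifferential (R := A) (S := B) 1
  have hfree : Module.Free B (Ω[B⁄A]) := inferInstance
  have hR : Module.finrank R (Ω[R⁄A]) = 1 := by
    rw [← e.finrank_eq, Module.finrank_baseChange, Module.finrank, hB]; simp
  have hfreeR : Module.Free R (Ω[R⁄A]) := Module.Free.of_equiv e
  have hfin : Module.Finite R (Ω[R⁄A]) := Module.Finite.equiv e
  let κ := IsLocalRing.ResidueField R
  have hκ : Algebra.FormallySmooth A κ := by
    let e' : A ≃ₐ[A] κ := AlgEquiv.ofBijective (Algebra.ofId A κ) h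
    exact Algebra.FormallySmooth.of_equiv e'
  have hsurj : Function.Surjective (algebraMap R κ) := IsLocalRing.residue_surjective
  obtain ⟨l, hl⟩ := (Algebra.FormallySmooth.iff_split_injection (R := A) hsurj).mp hκ
  have hinj : Function.Injective (KaehlerDifferential.kerCotangentToTensor A R κ) := fun x y hxy => by
    have := congrArg l hxy
    simpa using (LinearMap.congr_fun hl x).symm.trans (this.trans (LinearMap.congr_fun hl y))
  have hex : ∃ f : (RingHom.ker (algebraMap R κ)).Cotangent →ₗ[R] κ ⊗[R] (Ω[R⁄A]),
      Function.Injective f := ⟨_, hinj⟩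
  have hker : RingHom.ker (algebraMap R κ) = IsLocalRing.maximalIdeal R :=
    IsLocalRing.ker_residue
  rw [hker] at hex
  obtain ⟨f, hf⟩ := hex
  have hle : Module.finrank κ (IsLocalRing.CotangentSpace R) ≤ 1 := by
    let g : IsLocalRing.CotangentSpace R →ₗ[κ] κ ⊗[R] (Ω[R⁄A]) :=
      LinearMap.extendScalarsOfSurjective hsurj f
    refine (LinearMap.finrank_le_finrank_of_injective (f := g) hf).trans ?_
    rw [Module.finrank_baseChange, hR]
  have hnf : ¬ IsField R := by
    intro hF
    have hm : IsLocalRing.maximalIdeal R = ⊥ := (IsLocalRing.isField_iff_maximalIdeal_eq).mp hF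
    have hi : Function.Injective (algebraMap R κ) := by
      rw [RingHom.injective_iff_ker_eq_bot, hker, hm]
    have hs : Function.Surjective (algebraMap A R) := fun r => by
      obtain ⟨a, ha⟩ := h.2 (algebraMap R κ r)
      exact ⟨a, hi (by rw [← ha]; rfl)⟩
    have := KaehlerDifferential.subsingleton_of_surjective A R hs
    rw [Module.finrank_zero_of_subsingleton] at hR
    exact zero_ne_one hR
  exact ((IsDiscreteValuationRing.TFAE R hnf).out 0 4).mpr
    (((tfae_of_isNoetherianRing_of_isLocalRing_of_isDomain R).out 5 4).mp hle)

/-- The local ring at a closed point of a smooth curve is a discrete valuation ring. -/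
theorem isDVR_stalk {k : Type u} [Field k] [IsAlgClosed k] {X : Scheme.{u}}
    (f : X ⟶ Spec (.of k)) [IsIntegral X] [LocallyOfFiniteType f] [SmoothOfRelativeDimension 1 f]
    (x : X) (hx : IsClosed {x}) : IsDiscreteValuationRing (X.presheaf.stalk x) := by
  have : IsLocallyNoetherian X := LocallyOfFiniteType.isLocallyNoetherian f
  obtain ⟨U, hU, V, hV, hxV, e, hs⟩ :=
    SmoothOfRelativeDimension.exists_isStandardSmoothOfRelativeDimension (n := 1) (f := f) x
  have hUtop : U = ⊤ := by
    ext y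
    simpa [Subsingleton.elim y (f x)] using e hxV
  subst hUtop
  let c : CommRingCat.of k ⟶ X.residueField x :=
    (Scheme.ΓSpecIso (.of k)).inv ≫ f.appLE ⊤ V e ≫ X.presheaf.germ V x hxV ≫ X.residue x
  have hc : c = (residueFieldIsoBase f x hx).inv := by
    rw [← cancel_mono (Scheme.ΓSpecIso _).inv,
      Scheme.ΓSpecIso_inv_naturality (residueFieldIsoBase f x hx).inv,
      SpecMap_residueFieldIsoBase_inv, Scheme.fromSpecResidueField]
    have h0 : f.appLE ⊤ V e ≫ X.presheaf.germ V x hxV =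
        f.appTop ≫ X.presheaf.germ ⊤ x trivial := by
      rw [Scheme.Hom.appLE, Category.assoc, X.presheaf.germ_res]
      rfl
    simp only [c, Category.assoc, Scheme.Hom.comp_appTop, Scheme.fromSpecStalk_appTop, reassoc_of% h0]
    simp
  algebraize [(f.appLE ⊤ V e).hom, (X.presheaf.germ V x hxV).hom,
    ((X.presheaf.germ V x hxV).hom.comp (f.appLE ⊤ V e).hom)]
  have := hV.isLocalization_stalk ⟨x, hxV⟩
  refine isDVR_of_smooth (A := Γ(Spec (.of k), ⊤)) (B := Γ(X, V))
    (hV.primeIdealOf ⟨x, hxV⟩).asIdeal ?_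
  have h1 : Function.Bijective c := by
    rw [hc]; exact ConcreteCategory.bijective_of_isIso _
  have h2 : Function.Bijective (Scheme.ΓSpecIso (.of k)).inv :=
    ConcreteCategory.bijective_of_isIso _
  exact (Function.Bijective.of_comp_iff _ h2).mp h1

/-- A smooth (projective) curve over `k`: an integral scheme, proper and smooth of relative
dimension one over `k`. (A proper curve over a field is projective.) -/
structure SmoothCurve (k : Type u) [Field k] where
  /-- the underlying scheme -/
  X : Scheme.{u}
  /-- the structure morphism -/
  str : X ⟶ Spec (.of k)
  isIntegral : IsIntegral X
  isProper : IsProper str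
  smooth : SmoothOfRelativeDimension 1 str

attribute [local instance] MvPolynomial.gradedAlgebra

/-- The projective line over `k`, as the `Proj` of the graded ring `k[X₀, X₁]`. -/
def ProjLine (k : Type u) [Field k] : Scheme.{u} :=
  Proj (MvPolynomial.homogeneousSubmodule (Fin 2) k)

/-- The structure morphism of the projective line over `k`. -/
def ProjLine.str (k : Type u) [Field k] : ProjLine k ⟶ Spec (.of k) :=
  Proj.toSpecZero (MvPolynomial.homogeneousSubmodule (Fin 2) k) ≫
    Spec.map (CommRingCat.ofHom (algebraMap k (MvPolynomial.homogeneousSubmodule (Fin 2) k 0)))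

namespace SmoothCurve

variable {k : Type u} [Field k]

instance (C : SmoothCurve k) : IsIntegral C.X := C.isIntegral
instance (C : SmoothCurve k) : IsProper C.str := C.isProper
instance (C : SmoothCurve k) : SmoothOfRelativeDimension 1 C.str := C.smooth
instance (C : SmoothCurve k) : IsLocallyNoetherian C.X :=
  LocallyOfFiniteType.isLocallyNoetherian C.str

/-- The function field `k(X)` of a smooth curve. -/
abbrev FunField (C : SmoothCurve k) : Type u := C.X.functionField

/-- The function field of a curve over `k` is a `k`-algebra, through the structure morphism. -/
instance (C : SmoothCurve k) : Algebra k C.FunField :=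
  (((C.X.presheaf.germ ⊤ (genericPoint C.X) trivial).hom.comp C.str.appTop.hom).comp
    (Scheme.ΓSpecIso (.of k)).inv.hom).toAlgebra

/-- The points of a curve in the classical sense: the closed points of the scheme. -/
abbrev Point (C : SmoothCurve k) : Type u := closedPoints C.X

/-- Divisors on a curve: finite formal integral combinations of points, ordered pointwise. The
greatest common divisor of two divisors is their pointwise minimum `D ⊓ E`. -/
abbrev Div (C : SmoothCurve k) : Type u := C.Point →₀ ℤ

/-- The degree of a divisor on a curve over an algebraically closed field: the sum of its
coefficients (all points being rational). -/
def Div.deg {C : SmoothCurve k} (D : C.Div) : ℤ := D.sum fun _ m => m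

/-- Linear equivalence: `D - E` is the divisor of a nonzero rational function. For divisors this is
the same thing as an isomorphism of the line bundles `O(D)` and `O(E)`. -/
def LinEquiv {C : SmoothCurve k} (D E : C.Div) : Prop :=
  ∃ f : C.FunField, f ≠ 0 ∧ ∀ x : C.Point, Scheme.ord f x = D x - E x

/-- The space `H⁰(X, O(D))` of rational functions that are zero or satisfy `div f + D ≥ 0`. -/
def globalSections [IsAlgClosed k] {C : SmoothCurve k} (D : C.Div) : Submodule k C.FunField where
  carrier := {f | f ≠ 0 → ∀ x : C.Point, 0 ≤ Scheme.ord f x + D x}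
  zero_mem' h := (h rfl).elim
  add_mem' {f g} hf hg hfg x := by
    have := isDVR_stalk C.str x.1 x.2
    by_cases hf0 : f = 0
    · subst hf0
      simpa using hg (by simpa using hfg) x
    by_cases hg0 : g = 0
    · subst hg0
      simpa using hf hf0 x
    have h1 := hf hf0 x
    have h2 := hg hg0 x
    have h3 := Scheme.ord_add (x := x.1) hfg
    rcases min_le_iff.mp h3 with h | h <;> linarith
  smul_mem' c f hf hcf x := by
    have hc : c ≠ 0 := fun h => hcf (by simp [h])
    have hf0 : f ≠ 0 := fun h => hcf (by simp [h])
    have : Nonempty (⊤ : C.X.Opens) := ⟨⟨genericPoint C.X, trivial⟩⟩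
    let a : k →+* Γ(C.X, ⊤) := C.str.appTop.hom.comp (Scheme.ΓSpecIso (.of k)).inv.hom
    have hac : IsUnit (a c) := (IsUnit.mk0 c hc).map a
    have h := Scheme.ord_le_smul (x := x.1) (U := ⊤) trivial hac.ne_zero f
    have h2 : c • f = a c • f := rfl
    rw [h2]
    linarith [hf hf0 x]

/-- `h⁰(X, O(D))`, the dimension of `H⁰(X, O(D))`. -/
def h0 [IsAlgClosed k] {C : SmoothCurve k} (D : C.Div) : ℕ := Module.finrank k (globalSections D)

/-- `W` is a canonical divisor: the divisor of a nonzero rational differential `ω`. The coefficient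
of `W` at `x` is the order at `x` of the function `f` with `ω = f dt`, for `t` a uniformizer
at `x`. -/
def IsCanonical {C : SmoothCurve k} (W : C.Div) : Prop :=
  ∃ ω : Ω[C.FunField⁄k], ω ≠ 0 ∧ ∀ (x : C.Point) (t : C.FunField), Scheme.ord t x = 1 →
    ∃ f : C.FunField, ω = f • KaehlerDifferential.D k C.FunField t ∧ Scheme.ord f x = W x

/-- `O(L) ≃ K_X - D + E` is a presentation of the line bundle `O(L)`: the divisor `D` is effective
with `h⁰(X, O(D)) = 1` (a `g⁰_d`), `E > 0`, and `D` and `E` have greatest common divisor zero. -/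
structure IsPresentation [IsAlgClosed k] {C : SmoothCurve k} (L D E : C.Div) : Prop where
  effective : 0 ≤ D
  h0_eq_one : h0 D = 1
  pos : 0 < E
  gcd_eq_zero : D ⊓ E = 0
  equiv : ∃ W : C.Div, IsCanonical W ∧ LinEquiv L (W - D + E)

/-- The presentation `O(L) ≃ K_X - D + E` is minimal: `deg E` is the least possible among all
presentations of `O(L)`. -/
def IsMinimalPresentation [IsAlgClosed k] {C : SmoothCurve k} (L D E : C.Div) : Prop :=
  IsPresentation L D E ∧ ∀ D' E' : C.Div, IsPresentation L D' E' → E.deg ≤ E'.deg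

/-- The degree of a surjective morphism from a curve: the degree `[k(X) : k(Y)]` of the extension
of function fields. The generic point of `X` is sent to the generic point of `Y`, whose local ring
is `k(Y)`. -/
def mapDegree (C : SmoothCurve k) {Y : Scheme.{u}} (f : C.X ⟶ Y) : ℕ :=
  letI : Algebra (Y.presheaf.stalk (f (genericPoint C.X))) C.FunField :=
    (f.stalkMap (genericPoint C.X)).hom.toAlgebra
  Module.finrank (Y.presheaf.stalk (f (genericPoint C.X))) C.FunField

/-- An `n`-fold covering `φ : X → ℙ¹`: a finite surjective morphism over `k` of degree `n`. -/
structure Covering (C : SmoothCurve k) (n : ℕ) where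
  /-- the morphism -/
  φ : C.X ⟶ ProjLine k
  comp_str : φ ≫ ProjLine.str k = C.str
  isFinite : IsFinite φ
  surjective : Surjective φ
  degree_eq : C.mapDegree φ = n

/-- The multiplicity with which a point `x` occurs in the fibre of `f` through `x`: the length
of `O_x / m_y O_x`, where `y = f x`. It is the order at `x` of the pullback of a uniformizer
at `y`. -/
def multiplicity (C : SmoothCurve k) {Y : Scheme.{u}} (f : C.X ⟶ Y) (x : C.X) : ℕ :=
  (Module.length (C.X.presheaf.stalk x) (C.X.presheaf.stalk x ⧸
    (IsLocalRing.maximalIdeal (Y.presheaf.stalk (f x))).map (f.stalkMap x).hom)).toNat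

open Classical in
/-- The pullback `φ^*(P)` of a point `P` of `ℙ¹`: the sum of the points `x` over `P`, each counted
with its multiplicity. -/
def Covering.pullback {C : SmoothCurve k} {n : ℕ} (φ : C.Covering n)
    (P : closedPoints (ProjLine k)) : C.Div :=
  Finsupp.ofSupportFinite
    (fun x : C.Point => if φ.φ x.1 = P.1 then (C.multiplicity φ.φ x.1 : ℤ) else 0) <| by
    have := φ.isFinite
    refine ((φ.φ.finite_preimage_singleton P.1).preimage
      (Subtype.val_injective.injOn (s := Subtype.val ⁻¹' _))).subset fun x hx => ?_
    by_contra h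
    exact hx (if_neg h)

end SmoothCurve

end

open CategoryTheory AlgebraicGeometry TensorProduct

noncomputable section

attribute [local instance] MvPolynomial.gradedAlgebra

/-! ### Orders of rational functions at closed points. -/

namespace SmoothCurve
variable {k : Type u} [Field k]

/-! The proof is an exchange argument. Put `A = D ⊓ φ^*P` and `B = E ⊓ φ^*Q`. Since `φ^*P ~ φ^*Q`,
the bundle is also `K - D₁ + E₁` with `D₁ = (D - A) + (φ^*Q - B)` and `E₁ = (E - B) + (φ^*P - A)`,
both effective. As `deg φ^*P ≤ n`, if `deg A + deg B > n` then `deg E₁ < deg E`. This contradicts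
minimality once `(D₁, E₁)` is turned into a genuine presentation without raising the degree of the
second divisor.

That step is `exists_isPresentation`. A point common to both divisors is cancelled. If the gcd is
zero but `O(D₁)` has a nonconstant section, then a section vanishing at a point `p` of `E₁` replaces
`D₁` by an equivalent effective divisor containing `p`, and `p` is cancelled. Each move lowers the
degree of the second divisor by one. The process cannot end with that divisor equal to zero, because
`K - L` is not equivalent to an effective divisor as soon as `L` has one presentation
(`not_linEquiv`).

Two geometric inputs remain. `linEquiv_pullback` holds because a closed point of the line is the
zero of a linear form, and the pulled back quotient of two such forms has divisor `φ^*P - φ^*Q`.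
`deg_pullback_le` is the formula `∑ e f = n` over an affine chart, after multiplicities are
identified with ramification indices. -/

theorem ord_one {C : SmoothCurve k} (x : C.X) : Scheme.ord (1 : C.FunField) x = 0 := by
  have := Scheme.ord_mul (x := x) (one_ne_zero (α := C.FunField)) one_ne_zero
  rw [mul_one] at this
  omega

theorem ord_inv {C : SmoothCurve k} (x : C.X) {f : C.FunField} (hf : f ≠ 0) : Scheme.ord f⁻¹ x = - Scheme.ord f x := by
  have := Scheme.ord_mul (x := x) hf (inv_ne_zero hf)
  rw [mul_inv_cancel₀ hf, ord_one] at this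
  omega

/-- The inclusion of the constants in the local ring at a point. -/
def constants (C : SmoothCurve k) (x : C.X) : k →+* C.X.presheaf.stalk x :=
  ((C.X.presheaf.germ ⊤ x trivial).hom.comp C.str.appTop.hom).comp
    (Scheme.ΓSpecIso (.of k)).inv.hom

theorem algebraMap_constants (C : SmoothCurve k) (x : C.Point) (c : k) :
    algebraMap (C.X.presheaf.stalk x.1) C.FunField (C.constants x.1 c) = algebraMap k _ c := by
  have : Nonempty (⊤ : C.X.Opens) := ⟨⟨x.1, trivial⟩⟩
  exact Scheme.algebraMap_germ_eq_germToFunctionField (U := ⊤) C.X (x := x.1) trivial _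

variable [IsAlgClosed k] (C : SmoothCurve k)

instance isDVR_stalk_point (x : C.Point) : IsDiscreteValuationRing (C.X.presheaf.stalk x.1) :=
  isDVR_stalk C.str x.1 x.2

theorem coheight_point (x : C.Point) : Order.coheight x.1 = 1 := by
  have h := ringKrullDim_stalk_eq_coheight x.1
  have h1 : ringKrullDim (C.X.presheaf.stalk x.1) = 1 := IsDiscreteValuationRing.ringKrullDim_eq_one _
  rw [h1] at h
  exact_mod_cast h.symm

/-- Any point specializes to a closed point `y`, and the generizations of `y` are the primes of its
local ring. That ring is a discrete valuation ring, so there are only two of them. -/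
theorem isClosed_or_eq_genericPoint (x : C.X) : IsClosed {x} ∨ x = genericPoint C.X := by
  have : CompactSpace C.X := (quasiCompact_iff_compactSpace C.str).mp inferInstance
  obtain ⟨y, hy, hyc⟩ := IsClosed.exists_closed_singleton (S := closure {x}) isClosed_closure
    ⟨x, subset_closure rfl⟩
  have hxy : x ⤳ y := specializes_iff_mem_closure.mpr hy
  have := isDVR_stalk C.str y hyc
  have key : ∀ z : C.X, z ⤳ y → z = y ∨
      z = C.X.fromSpecStalk y (⊥ : PrimeSpectrum (C.X.presheaf.stalk y)) := fun z hz => by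
    have hz' : z ∈ Set.range (C.X.fromSpecStalk y) := by
      rw [Scheme.range_fromSpecStalk]; exact hz
    obtain ⟨p, rfl⟩ := hz'
    rcases eq_or_ne p.asIdeal ⊥ with h | h
    · exact .inr (congrArg _ (PrimeSpectrum.ext h))
    · left
      have hm : p.asIdeal = IsLocalRing.maximalIdeal _ :=
        IsLocalRing.eq_maximalIdeal (p.2.isMaximal h)
      have : p = IsLocalRing.closedPoint _ := PrimeSpectrum.ext hm
      rw [this, Scheme.fromSpecStalk_closedPoint]
  rcases key x hxy with rfl | h
  · exact .inl hyc
  · right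
    rcases key _ (genericPoint_specializes y) with h' | h'
    · exact (h' ▸ hxy : x ⤳ genericPoint C.X).antisymm (genericPoint_specializes x) |>.eq
    · rw [h, h']

/-- The function is a unit on some nonempty open set. The complement is a finite union of
irreducible closed sets, each the closure of a point other than the generic one, hence a single
closed point. -/
theorem finite_ord_ne_zero {f : C.FunField} (hf : f ≠ 0) :
    {x : C.Point | Scheme.ord f x.1 ≠ 0}.Finite := by
  have : CompactSpace C.X := (quasiCompact_iff_compactSpace C.str).mp inferInstance
  have : IsNoetherian C.X := {}
  obtain ⟨U, -, f', hU, rfl, hf'⟩ := exists_isUnit_germ_eq C.X f hf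
  have hfin : ((U : Set C.X)ᶜ).Finite := by
    obtain ⟨S, hS, hcl, hirr, h⟩ := TopologicalSpace.NoetherianSpace.exists_finite_set_isClosed_irreducible
      U.isOpen.isClosed_compl
    rw [h]
    refine hS.sUnion fun T hT => ?_
    obtain ⟨z, hz⟩ := QuasiSober.sober (hirr T hT) (hcl T hT)
    have hzU : z ∉ U := by
      have : z ∈ (U : Set C.X)ᶜ := h ▸ Set.mem_sUnion_of_mem hz.mem hT
      exact this
    rcases C.isClosed_or_eq_genericPoint z with h1 | h1
    · rw [← hz.def, h1.closure_eq]
      exact Set.finite_singleton z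
    · obtain ⟨u⟩ := hU
      exact absurd (h1 ▸ (genericPoint_specializes u.1).mem_open U.isOpen u.2) hzU
  refine (hfin.preimage Subtype.val_injective.injOn).subset fun x hx hxU => hx ?_
  exact Scheme.ord_of_isUnit hf' hxU

theorem ordFrac_eq_exp_ord (x : C.Point) {f : C.FunField} (hf : f ≠ 0) :
    Ring.ordFrac (C.X.presheaf.stalk x.1) f = WithZero.exp (Scheme.ord f x.1) :=
  (Scheme.ord_eq_iff (C.coheight_point x) hf).mp rfl

/-- `Ring.ordFrac` is the inverse of the multiplicative valuation, so nonnegative order is valuation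
at most one, which in a discrete valuation ring means integrality. -/
theorem ord_nonneg_iff (x : C.Point) {f : C.FunField} (hf : f ≠ 0) :
    0 ≤ Scheme.ord f x.1 ↔ ∃ s : C.X.presheaf.stalk x.1, algebraMap _ C.FunField s = f := by
  have h := C.ordFrac_eq_exp_ord x hf
  rw [Ring.ordFrac_eq_valuation_inv] at h
  constructor
  · intro h0
    obtain ⟨s, hs⟩ := IsDiscreteValuationRing.exists_lift_of_le_one
      (A := C.X.presheaf.stalk x.1) (x := f) (by
        rw [← inv_inv (IsDedekindDomain.HeightOneSpectrum.valuation _ _ _), h, ← WithZero.exp_neg,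
          ← WithZero.exp_zero, WithZero.exp_le_exp]
        omega)
    exact ⟨s, hs⟩
  · rintro ⟨s, rfl⟩
    have hs : s ≠ 0 := by rintro rfl; simp at hf
    have := Ring.ordFrac_ge_one_of_ne_zero (R := C.X.presheaf.stalk x.1) (K := C.FunField) hs
    rw [C.ordFrac_eq_exp_ord x hf, ← WithZero.exp_zero, WithZero.exp_le_exp] at this
    exact this

/-- `Ring.ord` is the length of the quotient by `s`; this form makes orders comparable with
`multiplicity`. -/
theorem ord_algebraMap (x : C.Point) {s : C.X.presheaf.stalk x.1} (hs : s ≠ 0) :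
    Scheme.ord (algebraMap _ C.FunField s) x.1 = (Ring.ord _ s).toNat := by
  have hs' : algebraMap _ C.FunField s ≠ 0 := by simpa using hs
  have hn := mem_nonZeroDivisors_of_ne_zero hs
  have h := C.ordFrac_eq_exp_ord x hs'
  rw [Ring.ordFrac_eq_ord _ hs, Ring.ordMonoidWithZeroHom_eq_coe (n := (Ring.ord _ s).toNat) _ hn
    (ENat.natCast_toNat (Ring.ord_ne_top hn)).symm] at h
  exact (WithZero.exp_injective h).symm

theorem one_le_ord_algebraMap (x : C.Point) {s : C.X.presheaf.stalk x.1} (hs : s ≠ 0)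
    (h : s ∈ IsLocalRing.maximalIdeal (C.X.presheaf.stalk x.1)) :
    1 ≤ Scheme.ord (algebraMap _ C.FunField s) x.1 := by
  have hs' : algebraMap _ C.FunField s ≠ 0 := by simpa using hs
  have h0 := (C.ord_nonneg_iff x hs').mpr ⟨s, rfl⟩
  have h1 : Scheme.ord (algebraMap _ C.FunField s) x.1 ≠ 0 := fun h1 => by
    have := C.ordFrac_eq_exp_ord x hs'
    rw [h1, WithZero.exp_zero, ← Ring.isUnit_iff_ordFrac_one_of_isDiscreteValuationRing] at this
    exact h this
  omega

/-- Over an algebraically closed field every closed point is rational: the map from constants to the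
residue field is the inverse of `residueFieldIsoBase`. -/
theorem residue_constants_surjective (x : C.Point) :
    Function.Surjective ((IsLocalRing.residue _).comp (C.constants x.1)) := by
  obtain ⟨x, hx⟩ := x
  have hx : IsClosed {x} := hx
  let c : CommRingCat.of k ⟶ C.X.residueField x :=
    (Scheme.ΓSpecIso (.of k)).inv ≫ C.str.appTop ≫ C.X.presheaf.germ ⊤ x trivial ≫ C.X.residue x
  have hc : c = (residueFieldIsoBase C.str x hx).inv := by
    rw [← cancel_mono (Scheme.ΓSpecIso _).inv,
      Scheme.ΓSpecIso_inv_naturality (residueFieldIsoBase C.str x hx).inv,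
      SpecMap_residueFieldIsoBase_inv, Scheme.fromSpecResidueField]
    simp only [c, Category.assoc, Scheme.Hom.comp_appTop, Scheme.fromSpecStalk_appTop]
    simp
  have : Function.Bijective c := by
    rw [hc]; exact ConcreteCategory.bijective_of_isIso _
  exact this.2

theorem exists_sub_mem_maximalIdeal (x : C.Point) {f : C.FunField} (hf : 0 ≤ Scheme.ord f x.1) :
    ∃ c : k, f - algebraMap k _ c ≠ 0 → 1 ≤ Scheme.ord (f - algebraMap k _ c) x.1 := by
  by_cases hf0 : f = 0
  · exact ⟨0, by simp [hf0]⟩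
  obtain ⟨s, rfl⟩ := (C.ord_nonneg_iff x hf0).mp hf
  obtain ⟨c, hc⟩ := C.residue_constants_surjective x (IsLocalRing.residue _ s)
  refine ⟨c, ?_⟩
  rw [← C.algebraMap_constants x, ← map_sub]
  intro h
  refine C.one_le_ord_algebraMap x (fun h' => h (by rw [h', map_zero])) ?_
  rw [← IsLocalRing.residue_eq_zero_iff, map_sub, sub_eq_zero]
  exact hc.symm

end SmoothCurve

/-! ### Coordinate rings of the standard charts of the projective line. -/

namespace ProjLine
variable {k : Type u} [Field k]

/-- The grading of `k[X₀, X₁]` by the degree. -/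
abbrev grading (k : Type u) [Field k] : ℕ → Submodule k (MvPolynomial (Fin 2) k) :=
  MvPolynomial.homogeneousSubmodule (Fin 2) k

theorem X_mem (i : Fin 2) : (MvPolynomial.X i : MvPolynomial (Fin 2) k) ∈ grading k 1 :=
  MvPolynomial.isHomogeneous_X k i

/-- The constants in the coordinate ring of the chart `X i ≠ 0`. -/
def chartC (k : Type u) [Field k] (i : Fin 2) :
    k →+* HomogeneousLocalization.Away (grading k) (MvPolynomial.X i) :=
  (HomogeneousLocalization.fromZeroRingHom (grading k) _).comp (algebraMap k (grading k 0))

/-- The fraction `a / X i`, for `a` a linear form. -/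
def chartFrac (i : Fin 2) (a : MvPolynomial (Fin 2) k) (ha : a ∈ grading k 1) :
    HomogeneousLocalization.Away (grading k) (MvPolynomial.X i) :=
  HomogeneousLocalization.mk ⟨1, ⟨a, ha⟩, ⟨MvPolynomial.X i, X_mem i⟩, Submonoid.mem_powers _⟩

/-- The ring homomorphism from `k[t]` to the coordinate ring of the chart `X i ≠ 0` sending `t` to
the quotient of the two variables. -/
def chartHom (k : Type u) [Field k] (i : Fin 2) : Polynomial k →+*
    HomogeneousLocalization.Away (grading k) (MvPolynomial.X i) :=
  Polynomial.eval₂RingHom (chartC k i) (chartFrac i (MvPolynomial.X i.rev) (X_mem _))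

theorem val_chartC (i : Fin 2) (c : k) :
    (chartC k i c).val = algebraMap _ _ (MvPolynomial.C c : MvPolynomial (Fin 2) k) :=
  Localization.mk_one_eq_algebraMap _

theorem val_chartFrac_mul (i : Fin 2) (a : MvPolynomial (Fin 2) k) (ha : a ∈ grading k 1) :
    algebraMap _ _ (MvPolynomial.X i : MvPolynomial (Fin 2) k) * (chartFrac i a ha).val =
      algebraMap _ _ a := by
  rw [chartFrac, HomogeneousLocalization.val_mk, Localization.mk_eq_mk', mul_comm]
  exact IsLocalization.mk'_spec _ _ _

/-- A degree-zero fraction `x / X i ^ n` is the image of the dehomogenization of `x`. Injectivity is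
not needed: surjectivity already makes the chart ring principal and lets its maximal ideals be
studied in `k[t]`. -/
theorem chartHom_surjective (i : Fin 2) : Function.Surjective (chartHom k i) := by
  intro z
  obtain ⟨n, x, hx, rfl⟩ := HomogeneousLocalization.Away.mk_surjective (grading k) (X_mem i) z
  have hx' : x.IsHomogeneous n := by simpa using hx
  refine ⟨∑ m ∈ x.support, Polynomial.C (x.coeff m) * Polynomial.X ^ m i.rev, ?_⟩
  apply HomogeneousLocalization.val_injective
  rw [HomogeneousLocalization.Away.val_mk, Localization.mk_eq_mk', IsLocalization.eq_mk'_iff_mul_eq]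
  set t := (chartFrac i (MvPolynomial.X i.rev : MvPolynomial (Fin 2) k) (X_mem _)).val with ht
  have hval : (chartHom k i (∑ m ∈ x.support, Polynomial.C (x.coeff m) * Polynomial.X ^ m i.rev)).val
      = ∑ m ∈ x.support, algebraMap (MvPolynomial (Fin 2) k)
        (Localization (Submonoid.powers (MvPolynomial.X i))) (MvPolynomial.C (x.coeff m)) * t ^ m i.rev := by
    rw [← HomogeneousLocalization.algebraMap_apply, map_sum, map_sum]
    refine Finset.sum_congr rfl fun m _ => ?_
    rw [map_mul, map_mul, map_pow, map_pow]
    simp [chartHom, HomogeneousLocalization.algebraMap_apply, val_chartC, ← ht]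
  rw [hval, Finset.sum_mul]
  conv_rhs => rw [x.as_sum, map_sum]
  refine Finset.sum_congr rfl fun m hm => ?_
  have hd : m i + m i.rev = n := by
    rw [← hx' (MvPolynomial.mem_support_iff.mp hm)]
    fin_cases i <;> simp [Finsupp.weight_apply, Finsupp.sum_fintype, Fin.sum_univ_two, add_comm]
  have hp : (MvPolynomial.monomial m (x.coeff m) : MvPolynomial (Fin 2) k) =
      MvPolynomial.C (x.coeff m) * (MvPolynomial.X i ^ m i * MvPolynomial.X i.rev ^ m i.rev) := by
    rw [MvPolynomial.monomial_eq, Finsupp.prod_fintype _ _ (by simp), Fin.prod_univ_two]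
    fin_cases i
    · rfl
    · simp [mul_comm]
  rw [hp, map_mul, map_mul, map_pow, map_pow _ (MvPolynomial.X i.rev), ← val_chartFrac_mul i (MvPolynomial.X i.rev) (X_mem _),
    ← ht, ← hd]
  rw [map_pow]
  ring

instance (i : Fin 2) : IsDomain (HomogeneousLocalization.Away (grading k) (MvPolynomial.X i)) := by
  have : IsDomain (Localization.Away (MvPolynomial.X i : MvPolynomial (Fin 2) k)) :=
    IsLocalization.isDomain_localization
      (powers_le_nonZeroDivisors_of_noZeroDivisors (MvPolynomial.X_ne_zero i))
  exact Function.Injective.isDomain (algebraMap _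
    (Localization.Away (MvPolynomial.X i : MvPolynomial (Fin 2) k)))
    (HomogeneousLocalization.val_injective _)

instance (i : Fin 2) : IsPrincipalIdealRing
    (HomogeneousLocalization.Away (grading k) (MvPolynomial.X i)) :=
  IsPrincipalIdealRing.of_surjective _ (chartHom_surjective i)

/-- The preimage of `q` in `k[t]` is maximal and nonzero. A nonzero member splits into linear
factors, so primality puts some `t - c` in the preimage, which it then generates. -/
theorem exists_eq_span_chartFrac [IsAlgClosed k] (i : Fin 2)
    (q : Ideal (HomogeneousLocalization.Away (grading k) (MvPolynomial.X i))) [q.IsMaximal] :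
    ∃ (l : MvPolynomial (Fin 2) k) (hl : l ∈ grading k 1) (c : k),
      l = MvPolynomial.X i.rev - MvPolynomial.C c * MvPolynomial.X i ∧
        q = Ideal.span {chartFrac i l hl} := by
  have hmax : (q.comap (chartHom k i)).IsMaximal :=
    Ideal.comap_isMaximal_of_surjective _ (chartHom_surjective i)
  have hne : q.comap (chartHom k i) ≠ ⊥ :=
    Ring.ne_bot_of_isMaximal_of_not_isField hmax (Polynomial.not_isField k)
  obtain ⟨p, hp, hp0⟩ := Submodule.exists_mem_ne_zero_of_ne_bot hne
  obtain ⟨c, hc⟩ : ∃ c : k, Polynomial.X - Polynomial.C c ∈ q.comap (chartHom k i) := by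
    rw [(IsAlgClosed.splits p).eq_prod_roots] at hp
    rcases hmax.isPrime.mem_or_mem hp with h | h
    · exact absurd (Ideal.eq_top_of_isUnit_mem _ h
        (by simpa using hp0)) hmax.ne_top
    · rw [hmax.isPrime.multiset_prod_mem_iff_exists_mem] at h
      obtain ⟨y, hy, h⟩ := h
      obtain ⟨a, -, rfl⟩ := Multiset.mem_map.mp hy
      exact ⟨a, h⟩
  have hspan : q.comap (chartHom k i) = Ideal.span {Polynomial.X - Polynomial.C c} := by
    refine (Ideal.IsMaximal.eq_of_le ?_ hmax.ne_top ?_).symm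
    · exact PrincipalIdealRing.isMaximal_of_irreducible (Polynomial.irreducible_X_sub_C c)
    · rwa [Ideal.span_singleton_le_iff_mem]
  have hl : (MvPolynomial.X i.rev - MvPolynomial.C c * MvPolynomial.X i : MvPolynomial (Fin 2) k)
      ∈ grading k 1 := by
    rw [← MvPolynomial.smul_eq_C_mul]
    exact sub_mem (X_mem _) (Submodule.smul_mem _ _ (X_mem _))
  refine ⟨_, hl, c, rfl, ?_⟩
  rw [← Ideal.map_comap_of_surjective _ (chartHom_surjective i) q, hspan, Ideal.map_span,
    Set.image_singleton]
  congr 2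
  apply HomogeneousLocalization.val_injective
  have hu : IsUnit (algebraMap (MvPolynomial (Fin 2) k) (Localization.Away
      (MvPolynomial.X i : MvPolynomial (Fin 2) k)) (MvPolynomial.X i)) :=
    IsLocalization.Away.algebraMap_isUnit _
  rw [← hu.mul_right_inj, val_chartFrac_mul]
  simp only [chartHom, Polynomial.coe_eval₂RingHom, Polynomial.eval₂_X,
    Polynomial.eval₂_C, HomogeneousLocalization.val_sub, mul_sub, val_chartFrac_mul, val_chartC,
    map_sub, map_mul]
  rw [mul_comm]

end ProjLine

/-! ### Local rings of the projective line and quotients of linear forms. -/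

namespace ProjLine
variable {k : Type u} [Field k]

instance (y : Proj (grading k)) : y.asHomogeneousIdeal.toIdeal.IsPrime := y.isPrime

/-- The quotient of two linear forms, as an element of the local ring at a point where the
denominator does not vanish. -/
def frac (y : Proj (grading k)) (a m : MvPolynomial (Fin 2) k) (ha : a ∈ grading k 1)
    (hm : m ∈ grading k 1) (hy : m ∉ y.asHomogeneousIdeal) : (Proj (grading k)).presheaf.stalk y :=
  (Proj.stalkIso (grading k) y).inv (HomogeneousLocalization.mk ⟨1, ⟨a, ha⟩, ⟨m, hm⟩, hy⟩)

theorem frac_mul_frac (y : Proj (grading k)) {a b c : MvPolynomial (Fin 2) k}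
    (ha : a ∈ grading k 1) (hb : b ∈ grading k 1) (hc : c ∈ grading k 1)
    (hby : b ∉ y.asHomogeneousIdeal) (hcy : c ∉ y.asHomogeneousIdeal) :
    frac y a b ha hb hby * frac y b c hb hc hcy = frac y a c ha hc hcy := by
  rw [frac, frac, frac, ← map_mul]
  congr 1
  apply HomogeneousLocalization.val_injective
  rw [HomogeneousLocalization.val_mul, HomogeneousLocalization.val_mk, HomogeneousLocalization.val_mk,
    HomogeneousLocalization.val_mk, Localization.mk_mul, Localization.mk_eq_mk_iff,
    Localization.r_iff_exists]
  exact ⟨1, by simp; ring⟩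

theorem frac_self (y : Proj (grading k)) {a : MvPolynomial (Fin 2) k}
    (ha : a ∈ grading k 1) (hay : a ∉ y.asHomogeneousIdeal) : frac y a a ha ha hay = 1 := by
  rw [frac, ← map_one (Proj.stalkIso (grading k) y).inv.hom]
  congr 1
  apply HomogeneousLocalization.val_injective
  rw [HomogeneousLocalization.val_mk, HomogeneousLocalization.val_one]
  exact Localization.mk_self (⟨a, hay⟩ : y.asHomogeneousIdeal.toIdeal.primeCompl)

theorem isUnit_frac_iff (y : Proj (grading k)) {a m : MvPolynomial (Fin 2) k}
    (ha : a ∈ grading k 1) (hm : m ∈ grading k 1) (hy : m ∉ y.asHomogeneousIdeal) :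
    IsUnit (frac y a m ha hm hy) ↔ a ∉ y.asHomogeneousIdeal := by
  constructor
  · intro h
    have h2 : IsUnit (HomogeneousLocalization.mk ⟨1, ⟨a, ha⟩, ⟨m, hm⟩, hy⟩ :
        HomogeneousLocalization.AtPrime (grading k) y.asHomogeneousIdeal.toIdeal) := by
      have := h.map (Proj.stalkIso (grading k) y).hom.hom
      rwa [frac, ← CommRingCat.comp_apply, Iso.inv_hom_id] at this
    rw [← HomogeneousLocalization.isUnit_iff_isUnit_val, HomogeneousLocalization.val_mk,
      Localization.mk_eq_mk'] at h2
    exact (IsLocalization.AtPrime.isUnit_mk'_iff _ y.asHomogeneousIdeal.toIdeal _ _).mp h2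
  · intro h
    exact .of_mul_eq_one _ ((frac_mul_frac y ha hm ha hy h).trans (frac_self y ha h))

theorem germ_awayToSection (y : Proj (grading k)) {a m : MvPolynomial (Fin 2) k}
    (ha : a ∈ grading k 1) (hm : m ∈ grading k 1) (hy : m ∉ y.asHomogeneousIdeal) :
    (Proj (grading k)).presheaf.germ (Proj.basicOpen (grading k) m) y hy
      (Proj.awayToSection (grading k) m
        (HomogeneousLocalization.mk ⟨1, ⟨a, ha⟩, ⟨m, hm⟩, Submonoid.mem_powers _⟩)) =
      frac y a m ha hm hy :=
  congr($(ProjectiveSpectrum.Proj.awayToSection_germ (grading k) m y hy)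
    (HomogeneousLocalization.mk ⟨1, ⟨a, ha⟩, ⟨m, hm⟩, Submonoid.mem_powers _⟩))

theorem stalkSpecializes_frac {y y' : Proj (grading k)} (h : y ⤳ y') {a m : MvPolynomial (Fin 2) k}
    (ha : a ∈ grading k 1) (hm : m ∈ grading k 1) (hy' : m ∉ y'.asHomogeneousIdeal)
    (hy : m ∉ y.asHomogeneousIdeal) :
    (Proj (grading k)).presheaf.stalkSpecializes h (frac y' a m ha hm hy') =
      frac y a m ha hm hy := by
  rw [← germ_awayToSection, ← germ_awayToSection]
  exact TopCat.Presheaf.germ_stalkSpecializes_apply (U := Proj.basicOpen (grading k) m) _ hy' h _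

theorem exists_X_notMem (y : Proj (grading k)) :
    ∃ i : Fin 2, (MvPolynomial.X i : MvPolynomial (Fin 2) k) ∉ y.asHomogeneousIdeal := by
  have h := Proj.iSup_basicOpen_eq_top' (grading k)
    (fun i : Fin 2 => (MvPolynomial.X i : MvPolynomial (Fin 2) k)) (fun i => ⟨1, X_mem i⟩) (by
      refine eq_top_iff.mpr fun p _ => ?_
      induction p using MvPolynomial.induction_on with
      | C c => exact Subalgebra.algebraMap_mem _ (algebraMap k (grading k 0) c)
      | add p q hp hq => exact add_mem (hp trivial) (hq trivial)
      | mul_X p i hp => exact mul_mem (hp trivial) (Algebra.subset_adjoin ⟨i, rfl⟩))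
  have hy : y ∈ ⨆ i : Fin 2, Proj.basicOpen (grading k) (MvPolynomial.X i) := h ▸ trivial
  exact TopologicalSpace.Opens.mem_iSup.mp hy

theorem isAffineOpen_chart (i : Fin 2) :
    IsAffineOpen (Proj.basicOpen (grading k) (MvPolynomial.X i)) :=
  Proj.isAffineOpen_basicOpen (grading k) _ (X_mem i) one_pos

/-- The coordinate ring of a chart of the projective line. -/
def chartEquiv (i : Fin 2) : HomogeneousLocalization.Away (grading k) (MvPolynomial.X i) ≃+*
    Γ(Proj (grading k), Proj.basicOpen (grading k) (MvPolynomial.X i)) :=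
  (Proj.basicOpenIsoAway (grading k) _ (X_mem i) one_pos).commRingCatIsoToRingEquiv

instance (i : Fin 2) :
    IsDomain Γ(Proj (grading k), Proj.basicOpen (grading k) (MvPolynomial.X i)) :=
  (chartEquiv i).symm.toMulEquiv.isDomain _

instance (i : Fin 2) :
    IsPrincipalIdealRing Γ(Proj (grading k), Proj.basicOpen (grading k) (MvPolynomial.X i)) :=
  IsPrincipalIdealRing.of_surjective _ (chartEquiv i).surjective

/-- A closed point of the projective line is cut out by a linear form, which vanishes at no other
closed point. -/
theorem exists_linear_form [IsAlgClosed k] {P : Proj (grading k)} (hP : IsClosed {P}) :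
    ∃ (l m : MvPolynomial (Fin 2) k) (hl : l ∈ grading k 1) (hm : m ∈ grading k 1)
      (hmP : m ∉ P.asHomogeneousIdeal),
      IsLocalRing.maximalIdeal ((Proj (grading k)).presheaf.stalk P) =
        Ideal.span {frac P l m hl hm hmP} ∧
      ∀ y : Proj (grading k), IsClosed {y} → y ≠ P → l ∉ y.asHomogeneousIdeal := by
  obtain ⟨i, hi⟩ := exists_X_notMem P
  have hU := isAffineOpen_chart (k := k) i
  have hPU : P ∈ Proj.basicOpen (grading k) (MvPolynomial.X i) := hi
  have hmax := hU.primeIdealOf_isMaximal_of_isClosed ⟨P, hPU⟩ hP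
  have := Ideal.comap_isMaximal_of_surjective (chartEquiv (k := k) i) (chartEquiv i).surjective
    (K := (hU.primeIdealOf ⟨P, hPU⟩).asIdeal)
  obtain ⟨l, hl, c, rfl, hq⟩ := exists_eq_span_chartFrac i
    ((hU.primeIdealOf ⟨P, hPU⟩).asIdeal.comap (chartEquiv (k := k) i))
  have hq' : (hU.primeIdealOf ⟨P, hPU⟩).asIdeal =
      Ideal.span {Proj.awayToSection (grading k) _ (chartFrac i _ hl)} := by
    rw [← Ideal.map_comap_of_surjective _ (chartEquiv (k := k) i).surjective
      (hU.primeIdealOf ⟨P, hPU⟩).asIdeal, hq, Ideal.map_span, Set.image_singleton]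
    rfl
  refine ⟨_, MvPolynomial.X i, hl, X_mem i, hi, ?_, fun y hy hne hly => hne ?_⟩
  · let := (Proj (grading k)).presheaf.algebra_section_stalk ⟨P, hPU⟩
    have := hU.isLocalization_stalk ⟨P, hPU⟩
    rw [← IsLocalization.AtPrime.map_eq_maximalIdeal (hU.primeIdealOf ⟨P, hPU⟩).asIdeal
      ((Proj (grading k)).presheaf.stalk P), hq', Ideal.map_span, Set.image_singleton,
      ← germ_awayToSection P hl (X_mem i) hi]
    rfl
  -- If `l` and `X i` both vanished at `y`, so would the other variable, which is impossible. Hence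
  -- `y` lies in the same chart as `P`, where `l` generates the maximal ideal of `P`.
  · have hyU : y ∈ Proj.basicOpen (grading k) (MvPolynomial.X i) := by
      intro hXi
      obtain ⟨j, hj⟩ := exists_X_notMem y
      have hrev : (MvPolynomial.X i.rev : MvPolynomial (Fin 2) k) ∈ y.asHomogeneousIdeal := by
        have := add_mem hly (Ideal.mul_mem_left y.asHomogeneousIdeal.toIdeal (MvPolynomial.C c) hXi)
        rwa [sub_add_cancel] at this
      refine hj ?_
      obtain rfl | rfl : j = i ∨ j = i.rev := (by decide : ∀ i j : Fin 2, j = i ∨ j = i.rev) i j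
      · exact hXi
      · exact hrev
    have hyU' : (MvPolynomial.X i : MvPolynomial (Fin 2) k) ∉ y.asHomogeneousIdeal := hyU
    have hymax := hU.primeIdealOf_isMaximal_of_isClosed ⟨y, hyU⟩ hy
    have hle : (hU.primeIdealOf ⟨P, hPU⟩).asIdeal ≤ (hU.primeIdealOf ⟨y, hyU⟩).asIdeal := by
      rw [hq', Ideal.span_singleton_le_iff_mem]
      by_contra hmem
      let := (Proj (grading k)).presheaf.algebra_section_stalk ⟨y, hyU⟩
      have := hU.isLocalization_stalk ⟨y, hyU⟩
      have hunit := IsLocalization.map_units ((Proj (grading k)).presheaf.stalk y)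
        (⟨_, hmem⟩ : (hU.primeIdealOf ⟨y, hyU⟩).asIdeal.primeCompl)
      have h2 : IsUnit (frac y _ (MvPolynomial.X i) hl (X_mem i) hyU') := by
        rw [← germ_awayToSection y hl (X_mem i) hyU']; exact hunit
      exact (isUnit_frac_iff _ _ _ _).mp h2 hly
    have heq := PrimeSpectrum.ext (hmax.eq_of_le hymax.ne_top hle)
    have h1 := hU.fromSpec_primeIdealOf ⟨y, hyU⟩
    rw [← heq, hU.fromSpec_primeIdealOf] at h1
    exact h1.symm

end ProjLine

/-! ### Multiplicities as ramification indices. -/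

theorem Module.length_quotient_map_ringEquiv {A B : Type*} [CommRing A] [CommRing B] (e : A ≃+* B)
    (I : Ideal A) : Module.length B (B ⧸ I.map (e : A →+* B)) = Module.length A (A ⧸ I) := by
  let := (e : A →+* B).toAlgebra
  let e' : A ≃ₐ[A] B := AlgEquiv.ofRingEquiv (f := e) fun _ => rfl
  rw [← Module.length_eq_of_surjective (R := B) (S := A) (M := B ⧸ I.map (e : A →+* B)) e.surjective]
  exact (Ideal.quotientEquivAlg I (I.map (e : A →+* B)) e' rfl).toLinearEquiv.length_eq.symm

/-- Frees the ramification index from the model `Localization.AtPrime q`, so that a stalk can be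
used as the localization. -/
theorem Ideal.ramificationIdx_eq_of_isLocalization {R S T : Type*} [CommRing R] [CommRing S]
    [CommRing T] [Algebra R S] [Algebra S T] (q : Ideal S) [q.IsPrime] [IsLocalization.AtPrime T q] :
    q.ramificationIdx R = (Module.length T
      (T ⧸ ((q.under R).map (algebraMap R S)).map (algebraMap S T))).toNat := by
  rw [Ideal.ramificationIdx_def]
  let e := IsLocalization.algEquiv q.primeCompl (Localization.AtPrime q) T
  rw [← Module.length_quotient_map_ringEquiv e.toRingEquiv, Ideal.map_map, Ideal.map_map]
  have : (e.toRingEquiv : Localization.AtPrime q →+* T).comp (algebraMap R (Localization.AtPrime q)) =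
      (algebraMap S T).comp (algebraMap R S) := by
    rw [IsScalarTower.algebraMap_eq R S (Localization.AtPrime q), ← RingHom.comp_assoc]
    congr 1
    exact e.toAlgHom.comp_algebraMap
  rw [this]

namespace SmoothCurve
variable {k : Type u} [Field k]

/-- The stalks at `x` and `f x` localize the section rings at the corresponding primes.
Compatibility of germs with the stalk map shows that the maximal ideal at `f x` and the prime below
`x` generate the same ideal in the stalk at `x`. -/
theorem multiplicity_eq_ramificationIdx (C : SmoothCurve k) {Y : Scheme.{u}} (f : C.X ⟶ Y)
    {U : Y.Opens} {V : C.X.Opens} (hU : IsAffineOpen U) (hV : IsAffineOpen V) (e : V ≤ f ⁻¹ᵁ U)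
    (x : C.X) (hx : x ∈ V) :
    letI := (f.appLE U V e).hom.toAlgebra
    C.multiplicity f x = (hV.primeIdealOf ⟨x, hx⟩).asIdeal.ramificationIdx Γ(Y, U) := by
  let := (f.appLE U V e).hom.toAlgebra
  let := C.X.presheaf.algebra_section_stalk ⟨x, hx⟩
  have := hV.isLocalization_stalk ⟨x, hx⟩
  let := Y.presheaf.algebra_section_stalk ⟨f x, e hx⟩
  have := hU.isLocalization_stalk ⟨f x, e hx⟩
  have hunder : (hV.primeIdealOf ⟨x, hx⟩).asIdeal.under Γ(Y, U) =
      (hU.primeIdealOf ⟨f x, e hx⟩).asIdeal :=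
    congr($(IsAffineOpen.comap_primeIdealOf_appLE U hU V hV e hx).1)
  have h1 := Ideal.ramificationIdx_eq_of_isLocalization (R := Γ(Y, U)) (T := C.X.presheaf.stalk x)
    (hV.primeIdealOf ⟨x, hx⟩).asIdeal
  have hm := IsLocalization.AtPrime.map_eq_maximalIdeal (hU.primeIdealOf ⟨f x, e hx⟩).asIdeal
      (Y.presheaf.stalk (f x))
  have key : (IsLocalRing.maximalIdeal (Y.presheaf.stalk (f x))).map (f.stalkMap x).hom =
      (((hV.primeIdealOf ⟨x, hx⟩).asIdeal.under Γ(Y, U)).map (algebraMap Γ(Y, U) Γ(C.X, V))).map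
        (algebraMap Γ(C.X, V) (C.X.presheaf.stalk x)) := by
    rw [hunder, ← hm, Ideal.map_map, Ideal.map_map]
    congr 1
    have := Scheme.Hom.germ_stalkMap f U x (e hx)
    have h2 : f.appLE U V e ≫ C.X.presheaf.germ V x hx =
        f.app U ≫ C.X.presheaf.germ (f ⁻¹ᵁ U) x (e hx) := by
      rw [Scheme.Hom.appLE, Category.assoc, C.X.presheaf.germ_res]
    exact congr(CommRingCat.Hom.hom $(this.trans h2.symm))
  rw [multiplicity, h1, key]

theorem multiplicity_eq_ramificationIdx_preimage (C : SmoothCurve k) {Y : Scheme.{u}} (f : C.X ⟶ Y)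
    {U : Y.Opens} (hU : IsAffineOpen U) (hV : IsAffineOpen (f ⁻¹ᵁ U)) (x : C.X) (hx : f x ∈ U) :
    letI := (f.app U).hom.toAlgebra
    C.multiplicity f x = (hV.primeIdealOf ⟨x, hx⟩).asIdeal.ramificationIdx Γ(Y, U) := by
  rw [Scheme.Hom.app_eq_appLE]
  exact C.multiplicity_eq_ramificationIdx f hU hV le_rfl x hx

/-! ### The degree of a fibre of a covering. -/

namespace Covering
open ProjLine
variable {C : SmoothCurve k} {n : ℕ} (φ : C.Covering n)

/-- A covering, as a morphism to the `Proj` of `k[X₀, X₁]`. -/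
abbrev toProj : C.X ⟶ Proj (grading k) := φ.φ

instance : IsFinite φ.toProj := φ.isFinite

/-- A chart of the projective line. -/
abbrev _root_.ProjLine.chart (k : Type u) [Field k] (i : Fin 2) : (Proj (grading k)).Opens :=
  Proj.basicOpen (grading k) (MvPolynomial.X i)

theorem genericPoint_mem_chart {i : Fin 2} {x : C.X} (hx : φ.toProj x ∈ chart k i) :
    φ.toProj (genericPoint C.X) ∈ chart k i :=
  ((genericPoint_specializes x).map φ.toProj.continuous).mem_open (chart k i).isOpen hx

/-- By surjectivity the image of the generic point specializes to every point of the line, in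
particular to the zero ideal of the chart. -/
theorem primeIdealOf_genericPoint (i : Fin 2) (h : φ.toProj (genericPoint C.X) ∈ chart k i) :
    ((isAffineOpen_chart i).primeIdealOf ⟨φ.toProj (genericPoint C.X), h⟩).asIdeal = ⊥ := by
  have hU := isAffineOpen_chart (k := k) i
  let z : Spec Γ(Proj (grading k), chart k i) := (⊥ : PrimeSpectrum Γ(Proj (grading k), chart k i))
  obtain ⟨x, hx⟩ := φ.surjective.surj (hU.fromSpec z)
  have h1 : φ.toProj (genericPoint C.X) ⤳ φ.toProj x :=
    (genericPoint_specializes x).map φ.toProj.continuous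
  have hx' : φ.toProj x = hU.fromSpec z := hx
  have h0 : hU.fromSpec (hU.primeIdealOf ⟨_, h⟩) = φ.toProj (genericPoint C.X) :=
    hU.fromSpec_primeIdealOf ⟨_, h⟩
  rw [hx', ← h0] at h1
  exact le_bot_iff.mp ((PrimeSpectrum.le_iff_specializes _ _).mpr
    (hU.fromSpec.isOpenEmbedding.isInducing.specializes_iff.mp h1))

theorem isFractionRing_chart (i : Fin 2) (h : φ.toProj (genericPoint C.X) ∈ chart k i) :
    letI := (Proj (grading k)).presheaf.algebra_section_stalk ⟨_, h⟩
    IsFractionRing Γ(Proj (grading k), chart k i)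
      ((Proj (grading k)).presheaf.stalk (φ.toProj (genericPoint C.X))) := by
  let := (Proj (grading k)).presheaf.algebra_section_stalk ⟨_, h⟩
  have h1 := (isAffineOpen_chart (k := k) i).isLocalization_stalk ⟨_, h⟩
  unfold IsLocalization.AtPrime at h1
  have h2 : ((isAffineOpen_chart i).primeIdealOf ⟨φ.toProj (genericPoint C.X), h⟩).asIdeal.primeCompl
      = nonZeroDivisors _ := by
    ext a
    rw [Ideal.mem_primeCompl_iff, φ.primeIdealOf_genericPoint i h, mem_nonZeroDivisors_iff_ne_zero]
    rfl
  rw [h2] at h1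
  exact h1

/-- Both section rings have the corresponding stalks at the generic points as fraction fields, so
the rank of the finite extension is the degree of the function field extension. -/
theorem finrank_chart (i : Fin 2) (h : φ.toProj (genericPoint C.X) ∈ chart k i) :
    letI := (φ.toProj.app (chart k i)).hom.toAlgebra
    Module.finrank Γ(Proj (grading k), chart k i) Γ(C.X, φ.toProj ⁻¹ᵁ chart k i) = n ∧
      FaithfulSMul Γ(Proj (grading k), chart k i) Γ(C.X, φ.toProj ⁻¹ᵁ chart k i) := by
  let y := φ.toProj (genericPoint C.X)
  have hU := isAffineOpen_chart (k := k) i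
  have hV : IsAffineOpen (φ.toProj ⁻¹ᵁ chart k i) := hU.preimage φ.toProj
  have : Nonempty (φ.toProj ⁻¹ᵁ chart k i) := ⟨⟨_, h⟩⟩
  let := (φ.toProj.app (chart k i)).hom.toAlgebra
  let := (Proj (grading k)).presheaf.algebra_section_stalk ⟨y, h⟩
  have := φ.isFractionRing_chart i h
  have := functionField_isFractionRing_of_isAffineOpen C.X (φ.toProj ⁻¹ᵁ chart k i) hV
  let : Algebra ((Proj (grading k)).presheaf.stalk y) C.FunField :=
    (φ.toProj.stalkMap (genericPoint C.X)).hom.toAlgebra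
  let : Algebra Γ(Proj (grading k), chart k i) C.FunField :=
    ((algebraMap Γ(C.X, φ.toProj ⁻¹ᵁ chart k i) C.FunField).comp
      (algebraMap Γ(Proj (grading k), chart k i) Γ(C.X, φ.toProj ⁻¹ᵁ chart k i))).toAlgebra
  have : IsScalarTower Γ(Proj (grading k), chart k i) Γ(C.X, φ.toProj ⁻¹ᵁ chart k i)
    C.FunField := .of_algebraMap_eq' rfl
  have : IsScalarTower Γ(Proj (grading k), chart k i) ((Proj (grading k)).presheaf.stalk y)
      C.FunField := .of_algebraMap_eq' <|
    congr(CommRingCat.Hom.hom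
      $(Scheme.Hom.germ_stalkMap φ.toProj (chart k i) (genericPoint C.X) h)).symm
  let : Field ((Proj (grading k)).presheaf.stalk y) :=
    IsFractionRing.toField Γ(Proj (grading k), chart k i)
  have hinj : Function.Injective (algebraMap Γ(Proj (grading k), chart k i) C.FunField) := by
    rw [IsScalarTower.algebraMap_eq _ ((Proj (grading k)).presheaf.stalk y),
      RingHom.coe_comp]
    exact (RingHom.injective _).comp (IsFractionRing.injective Γ(Proj (grading k), chart k i)
      ((Proj (grading k)).presheaf.stalk y))
  have hf : FaithfulSMul Γ(Proj (grading k), chart k i) Γ(C.X, φ.toProj ⁻¹ᵁ chart k i) := by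
    rw [faithfulSMul_iff_algebraMap_injective]
    rw [IsScalarTower.algebraMap_eq _ Γ(C.X, φ.toProj ⁻¹ᵁ chart k i)] at hinj
    exact Function.Injective.of_comp hinj
  refine ⟨?_, hf⟩
  have : Module.Finite Γ(Proj (grading k), chart k i) Γ(C.X, φ.toProj ⁻¹ᵁ chart k i) :=
    IsFinite.finite_app φ.toProj _ hU
  rw [← IsFractionRing.finrank_eq Γ(Proj (grading k), chart k i)
    ((Proj (grading k)).presheaf.stalk y) Γ(C.X, φ.toProj ⁻¹ᵁ chart k i) C.FunField]
  exact φ.degree_eq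

theorem _root_.Finset.sum_comp_le_of_injective {ι κ : Type*} [Fintype κ] (s : Finset ι) (g : s → κ)
    (hg : Function.Injective g) (a : ι → ℕ) (b : κ → ℕ) (h : ∀ x : s, a x ≤ b (g x)) :
    ∑ x ∈ s, a x ≤ ∑ y, b y := by
  rw [← Finset.sum_coe_sort]
  calc ∑ x : s, a x ≤ ∑ x : s, b (g x) := Finset.sum_le_sum fun x _ => h x
    _ = ∑ y ∈ Finset.univ.map ⟨g, hg⟩, b y := by simp
    _ ≤ ∑ y, b y := Finset.sum_le_sum_of_subset (Finset.subset_univ _)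

theorem pullback_apply_of_eq (P : closedPoints (ProjLine k)) {x : C.Point} (h : φ.φ x.1 = P.1) :
    φ.pullback P x = C.multiplicity φ.φ x.1 := if_pos h

theorem pullback_apply_of_ne (P : closedPoints (ProjLine k)) {x : C.Point} (h : φ.φ x.1 ≠ P.1) :
    φ.pullback P x = 0 := if_neg h

/-- The fibres of an `n`-fold covering have degree at most `n`. -/
theorem deg_pullback_le (P : closedPoints (ProjLine k)) : (φ.pullback P).deg ≤ n := by
  by_cases hsupp : (φ.pullback P).support = ∅
  · rw [Finsupp.support_eq_empty.mp hsupp]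
    simp [Div.deg]
  have hover : ∀ x ∈ (φ.pullback P).support, φ.φ x.1 = P.1 := fun x hx => by
    by_contra h
    exact Finsupp.mem_support_iff.mp hx (φ.pullback_apply_of_ne P h)
  obtain ⟨i, hi⟩ := exists_X_notMem (k := k) P.1
  have hPU : (P.1 : Proj (grading k)) ∈ chart k i := hi
  have hxU : ∀ x ∈ (φ.pullback P).support, φ.toProj x.1 ∈ chart k i := fun x hx => by
    have := hover x hx
    exact this ▸ hPU
  obtain ⟨x₀, hx₀⟩ := Finset.nonempty_iff_ne_empty.mpr hsupp
  obtain ⟨hn, hf⟩ := φ.finrank_chart i (φ.genericPoint_mem_chart (hxU x₀ hx₀))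
  have hU := isAffineOpen_chart (k := k) i
  have hV : IsAffineOpen (φ.toProj ⁻¹ᵁ chart k i) := hU.preimage φ.toProj
  have : Nonempty (φ.toProj ⁻¹ᵁ chart k i) := ⟨⟨_, hxU x₀ hx₀⟩⟩
  let := (φ.toProj.app (chart k i)).hom.toAlgebra
  have : Module.Finite Γ(Proj (grading k), chart k i) Γ(C.X, φ.toProj ⁻¹ᵁ chart k i) :=
    IsFinite.finite_app φ.toProj _ hU
  let p := (hU.primeIdealOf ⟨P.1, hPU⟩).asIdeal
  have : Finite (p.primesOver Γ(C.X, φ.toProj ⁻¹ᵁ chart k i)) := Algebra.QuasiFinite.finite_primesOver p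
  let := Fintype.ofFinite (p.primesOver Γ(C.X, φ.toProj ⁻¹ᵁ chart k i))
  have hsum := Ideal.sum_ramification_inertia_eq_finrank p Γ(C.X, φ.toProj ⁻¹ᵁ chart k i)
  rw [hn] at hsum
  have hcomap : ∀ x (hx : x ∈ (φ.pullback P).support),
      (hV.primeIdealOf ⟨x.1, hxU x hx⟩).asIdeal.under Γ(Proj (grading k), chart k i) = p := by
    intro x hx
    have h1 := IsAffineOpen.comap_primeIdealOf_appLE (f := φ.toProj) (chart k i) hU _ hV le_rfl
      (hxU x hx)
    rw [← Scheme.Hom.app_eq_appLE] at h1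
    have h2 : (⟨φ.toProj x.1, hxU x hx⟩ : chart k i) = ⟨P.1, hPU⟩ := Subtype.ext (hover x hx)
    rw [h2] at h1
    exact congrArg PrimeSpectrum.asIdeal h1
  have hdeg : (φ.pullback P).deg =
      ((∑ x ∈ (φ.pullback P).support, C.multiplicity φ.φ x.1 : ℕ) : ℤ) := by
    rw [Div.deg, Finsupp.sum, Nat.cast_sum]
    exact Finset.sum_congr rfl fun x hx => φ.pullback_apply_of_eq P (hover x hx)
  rw [hdeg, Nat.cast_le]
  refine le_trans ?_ hsum.le
  -- Distinct points of the fibre give distinct primes over `p`. An injection suffices for the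
  -- inequality; that every prime over `p` occurs is not needed.
  refine Finset.sum_comp_le_of_injective _ (fun x =>
    ⟨(hV.primeIdealOf ⟨x.1.1, hxU x.1 x.2⟩).asIdeal, inferInstance, ⟨(hcomap x.1 x.2).symm⟩⟩) ?_ _ _ ?_
  · intro x y hxy
    have h1 : hV.primeIdealOf ⟨x.1.1, hxU x.1 x.2⟩ = hV.primeIdealOf ⟨y.1.1, hxU y.1 y.2⟩ :=
      PrimeSpectrum.ext (congrArg Subtype.val hxy)
    have h2 := congrArg hV.fromSpec h1
    rw [hV.fromSpec_primeIdealOf, hV.fromSpec_primeIdealOf] at h2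
    exact Subtype.ext (Subtype.ext h2)
  · intro x
    have := C.multiplicity_eq_ramificationIdx_preimage φ.toProj hU hV x.1.1 (hxU x.1 x.2)
    -- The term for a prime is `e * f`; positivity of `f` is enough to bound the multiplicity `e`.
    refine this.le.trans (Nat.le_mul_of_pos_right _ (Ideal.inertiaDeg_pos _ _))

end Covering
end SmoothCurve

/-! ### Fibres as divisors of pulled back linear forms. -/

namespace SmoothCurve
namespace Covering
open ProjLine
variable {k : Type u} [Field k] {C : SmoothCurve k} {n : ℕ} (φ : C.Covering n)

theorem isClosed_apply (x : C.Point) : IsClosed {φ.toProj x.1} := by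
  have h : IsClosed {x.1} := x.2
  have := φ.toProj.isClosedMap _ h
  rwa [Set.image_singleton] at this

theorem notMem_genericPoint {x : C.X} {m : MvPolynomial (Fin 2) k}
    (h : m ∉ (φ.toProj x).asHomogeneousIdeal) :
    m ∉ (φ.toProj (genericPoint C.X)).asHomogeneousIdeal :=
  ((genericPoint_specializes x).map φ.toProj.continuous).mem_open
    (Proj.basicOpen (grading k) m).isOpen h

/-- The pullback to the function field of a quotient of linear forms. -/
def pullbackFrac (a m : MvPolynomial (Fin 2) k) (ha : a ∈ grading k 1) (hm : m ∈ grading k 1)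
    (h : m ∉ (φ.toProj (genericPoint C.X)).asHomogeneousIdeal) : C.FunField :=
  φ.toProj.stalkMap (genericPoint C.X) (frac _ a m ha hm h)

theorem pullbackFrac_mul_pullbackFrac {a m : MvPolynomial (Fin 2) k} (ha : a ∈ grading k 1)
    (hm : m ∈ grading k 1) (h : m ∉ (φ.toProj (genericPoint C.X)).asHomogeneousIdeal)
    (h' : a ∉ (φ.toProj (genericPoint C.X)).asHomogeneousIdeal) :
    φ.pullbackFrac a m ha hm h * φ.pullbackFrac m a hm ha h' = 1 := by
  rw [pullbackFrac, pullbackFrac, ← map_mul, frac_mul_frac _ ha hm ha h h', frac_self, map_one]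

theorem algebraMap_stalkMap_frac (x : C.X) {a m : MvPolynomial (Fin 2) k} (ha : a ∈ grading k 1)
    (hm : m ∈ grading k 1) (h : m ∉ (φ.toProj x).asHomogeneousIdeal) :
    algebraMap (C.X.presheaf.stalk x) C.FunField (φ.toProj.stalkMap x (frac _ a m ha hm h)) =
      φ.pullbackFrac a m ha hm (φ.notMem_genericPoint h) := by
  rw [pullbackFrac, ← stalkSpecializes_frac
    ((genericPoint_specializes x).map φ.toProj.continuous) ha hm h]
  exact (Scheme.Hom.stalkSpecializes_stalkMap_apply φ.toProj _ _ (genericPoint_specializes x) _).symm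

variable [IsAlgClosed k]

theorem ord_pullbackFrac_of_notMem (x : C.Point) {a m : MvPolynomial (Fin 2) k}
    (ha : a ∈ grading k 1) (hm : m ∈ grading k 1) (h : m ∉ (φ.toProj x.1).asHomogeneousIdeal)
    (hax : a ∉ (φ.toProj x.1).asHomogeneousIdeal) :
    Scheme.ord (φ.pullbackFrac a m ha hm (φ.notMem_genericPoint h)) x.1 = 0 := by
  have hu : IsUnit (φ.toProj.stalkMap x.1 (frac _ a m ha hm h)) :=
    ((isUnit_frac_iff _ ha hm h).mpr hax).map (φ.toProj.stalkMap x.1).hom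
  rw [← φ.algebraMap_stalkMap_frac x.1 ha hm h, C.ord_algebraMap x hu.ne_zero, Ring.ord_of_isUnit hu]
  rfl

/-- Changing the denominator multiplies the generator of the maximal ideal by a unit. Order and
multiplicity are then the length of the same quotient of the stalk at `x`. The condition `hag` makes
the pulled back element nonzero. -/
theorem ord_pullbackFrac_of_span_eq (x : C.Point) {a m m' : MvPolynomial (Fin 2) k}
    (ha : a ∈ grading k 1) (hm : m ∈ grading k 1) (hm' : m' ∈ grading k 1)
    (h : m ∉ (φ.toProj x.1).asHomogeneousIdeal) (h' : m' ∉ (φ.toProj x.1).asHomogeneousIdeal)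
    (hag : a ∉ (φ.toProj (genericPoint C.X)).asHomogeneousIdeal)
    (hspan : IsLocalRing.maximalIdeal ((Proj (grading k)).presheaf.stalk (φ.toProj x.1)) =
      Ideal.span {frac _ a m ha hm h}) :
    Scheme.ord (φ.pullbackFrac a m' ha hm' (φ.notMem_genericPoint h')) x.1 =
      C.multiplicity φ.toProj x.1 := by
  have hspan' : IsLocalRing.maximalIdeal ((Proj (grading k)).presheaf.stalk (φ.toProj x.1)) =
      Ideal.span {frac _ a m' ha hm' h'} := by
    rw [hspan, ← frac_mul_frac _ ha hm hm' h h',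
      Ideal.span_singleton_mul_right_unit ((isUnit_frac_iff _ hm hm' h').mpr h)]
  have hs : φ.toProj.stalkMap x.1 (frac _ a m' ha hm' h') ≠ 0 := fun h0 => by
    have h1 := φ.pullbackFrac_mul_pullbackFrac ha hm' (φ.notMem_genericPoint h') hag
    rw [← φ.algebraMap_stalkMap_frac x.1 ha hm' h', h0, map_zero, zero_mul] at h1
    exact zero_ne_one h1
  rw [← φ.algebraMap_stalkMap_frac x.1 ha hm' h', C.ord_algebraMap x hs, multiplicity, hspan', Ideal.map_span,
    Set.image_singleton]
  rfl

/-- The fibre over a closed point is the divisor of a linear form. -/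
theorem exists_linear_form_ord (P : closedPoints (ProjLine k)) :
    ∃ (l : MvPolynomial (Fin 2) k) (hl : l ∈ grading k 1),
      (∀ y : Proj (grading k), IsClosed {y} → y ≠ P.1 → l ∉ y.asHomogeneousIdeal) ∧
      (l ∉ (φ.toProj (genericPoint C.X)).asHomogeneousIdeal →
        ∀ (x : C.Point) (m : MvPolynomial (Fin 2) k) (hm : m ∈ grading k 1)
        (h : m ∉ (φ.toProj x.1).asHomogeneousIdeal),
        Scheme.ord (φ.pullbackFrac l m hl hm (φ.notMem_genericPoint h)) x.1 = φ.pullback P x) := by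
  obtain ⟨P, hP⟩ := P
  obtain ⟨l, m₀, hl, hm₀, hmP, hspan, hlP⟩ := exists_linear_form (P := P) hP
  refine ⟨l, hl, hlP, fun hlg x m hm h => ?_⟩
  by_cases hx : φ.toProj x.1 = P
  · rw [φ.pullback_apply_of_eq ⟨P, hP⟩ hx]
    subst hx
    exact φ.ord_pullbackFrac_of_span_eq x hl hm₀ hm hmP h hlg hspan
  · rw [φ.pullback_apply_of_ne ⟨P, hP⟩ hx]
    exact φ.ord_pullbackFrac_of_notMem x hl hm h (hlP _ (φ.isClosed_apply x) hx)

/-- Any two fibres of a covering of the projective line are linearly equivalent. -/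
theorem linEquiv_pullback (P Q : closedPoints (ProjLine k)) :
    LinEquiv (φ.pullback P) (φ.pullback Q) := by
  by_cases hPQ : P = Q
  · subst hPQ
    exact ⟨1, one_ne_zero, fun x => by rw [ord_one, sub_self]⟩
  have hne : P.1 ≠ Q.1 := fun h => hPQ (Subtype.ext h)
  obtain ⟨l, hl, hlP, hordP⟩ := φ.exists_linear_form_ord P
  obtain ⟨l', hl', hlQ, hordQ⟩ := φ.exists_linear_form_ord Q
  -- A point over `Q` shows that `l` does not vanish at the image of the generic point, and a point
  -- over `P` does the same for `l'`. Hence the pullback of `l / l'` is a nonzero rational function.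
  obtain ⟨p, hp⟩ := φ.surjective.surj P.1
  obtain ⟨q, hq⟩ := φ.surjective.surj Q.1
  have hlq : l ∉ (φ.toProj q).asHomogeneousIdeal :=
    hlP _ (by have := Q.2; rwa [← hq] at this) (by rw [← hq] at hne; exact hne.symm)
  have hlp : l' ∉ (φ.toProj p).asHomogeneousIdeal :=
    hlQ _ (by have := P.2; rwa [← hp] at this) (by rw [← hp] at hne; exact hne)
  have hlg := φ.notMem_genericPoint hlq
  have hlg' := φ.notMem_genericPoint hlp
  have hmul := φ.pullbackFrac_mul_pullbackFrac hl hl' hlg' hlg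
  have hne0 := left_ne_zero_of_mul_eq_one hmul
  refine ⟨_, hne0, fun x => ?_⟩
  -- Over `Q` the denominator `l'` vanishes, so the order is computed from the inverse `l' / l`;
  -- elsewhere `l / l'` is itself a local quotient.
  by_cases h : φ.toProj x.1 = Q.1
  · have hxP : φ.toProj x.1 ≠ P.1 := h ▸ hne.symm
    rw [eq_inv_of_mul_eq_one_left hmul, ord_inv _ (right_ne_zero_of_mul_eq_one hmul),
      φ.pullback_apply_of_ne P hxP, zero_sub,
      ← hordQ hlg' x l hl (hlP _ (φ.isClosed_apply x) hxP)]
  · rw [φ.pullback_apply_of_ne Q h, sub_zero,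
      ← hordP hlg x l' hl' (hlQ _ (φ.isClosed_apply x) h)]

end Covering
end SmoothCurve

/-! ### Effective divisors, sections and presentations. -/

namespace SmoothCurve
variable {k : Type u} [Field k] {C : SmoothCurve k}

theorem Div.deg_add (D E : C.Div) : (D + E).deg = D.deg + E.deg :=
  Finsupp.sum_add_index' (fun _ => rfl) fun _ _ _ => rfl

theorem Div.deg_sub (D E : C.Div) : (D - E).deg = D.deg - E.deg :=
  Finsupp.sum_sub_index fun _ _ _ => rfl

theorem Div.deg_single (p : C.Point) (m : ℤ) : Div.deg (Finsupp.single p m : C.Div) = m :=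
  Finsupp.sum_single_index rfl

theorem Div.deg_nonneg {D : C.Div} (h : 0 ≤ D) : 0 ≤ D.deg :=
  Finset.sum_nonneg fun x _ => h x

/-- Twisting a linear equivalence by a principal divisor. -/
theorem LinEquiv.of_ord_eq {D E F : C.Div} (h : LinEquiv D E) {f : C.FunField} (hf : f ≠ 0)
    (hF : ∀ x : C.Point, Scheme.ord f x.1 = E x - F x) : LinEquiv D F := by
  obtain ⟨g, hg, h⟩ := h
  exact ⟨g * f, mul_ne_zero hg hf, fun x => by rw [Scheme.ord_mul hg hf, h, hF]; ring⟩

theorem sub_single_nonneg {D : C.Div} (hD : 0 ≤ D) {p : C.Point} (hp : 1 ≤ D p) :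
    0 ≤ D - Finsupp.single p 1 := fun x => by
  by_cases h : x = p
  · subst h; simpa using hp
  · simpa [Finsupp.single_apply, Ne.symm h] using hD x

variable [IsAlgClosed k]

/-- Both `c` and `c⁻¹` are scalar multiples of `1`, hence sections of `O`, so neither has a pole. -/
theorem ord_algebraMap_const {c : k} (hc : c ≠ 0) (x : C.Point) :
    Scheme.ord (algebraMap k C.FunField c) x.1 = 0 := by
  have key : ∀ c : k, c ≠ 0 → 0 ≤ Scheme.ord (algebraMap k C.FunField c) x.1 := fun c hc => by
    have h1 : (1 : C.FunField) ∈ globalSections (0 : C.Div) := fun _ y => by rw [ord_one]; rfl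
    have h2 := (globalSections (0 : C.Div)).smul_mem c h1
    rw [← Algebra.algebraMap_eq_smul_one] at h2
    simpa using h2 (by simpa using hc) x
  have h := key c⁻¹ (inv_ne_zero hc)
  rw [map_inv₀, ord_inv _ (by simpa using hc)] at h
  linarith [key c hc]

theorem one_mem_globalSections {D : C.Div} (hD : 0 ≤ D) : (1 : C.FunField) ∈ globalSections D :=
  fun _ x => by rw [ord_one, zero_add]; exact hD x

/-- For `D` effective, `h⁰(D) = 1` means that all sections of `O(D)` are constant. -/
theorem h0_eq_one_iff {D : C.Div} (hD : 0 ≤ D) :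
    h0 D = 1 ↔ ∀ f ∈ globalSections D, ∃ c : k, algebraMap k C.FunField c = f := by
  have h1 : (⟨1, one_mem_globalSections hD⟩ : globalSections D) ≠ 0 := fun h =>
    one_ne_zero (congrArg Subtype.val h)
  rw [h0, finrank_eq_one_iff_of_nonzero' _ h1]
  constructor
  · intro h f hf
    obtain ⟨c, hc⟩ := h ⟨f, hf⟩
    exact ⟨c, by rw [Algebra.algebraMap_eq_smul_one]; exact congrArg Subtype.val hc⟩
  · rintro h ⟨f, hf⟩
    obtain ⟨c, rfl⟩ := h f hf
    exact ⟨c, Subtype.ext (Algebra.algebraMap_eq_smul_one c).symm⟩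

/-- The divisor of a nonzero rational function. -/
def principalDiv (f : C.FunField) (hf : f ≠ 0) : C.Div :=
  Finsupp.ofSupportFinite (fun x => Scheme.ord f x.1) (C.finite_ord_ne_zero hf)

theorem principalDiv_apply (f : C.FunField) (hf : f ≠ 0) (x : C.Point) :
    principalDiv f hf x = Scheme.ord f x.1 := rfl

/-- If `O(D)` has a nonconstant section and the effective divisor `D` does not contain `p`, then a
section of `O(D)` vanishes at `p`. -/
theorem exists_section_vanishing {D : C.Div} (hD : 0 ≤ D) (h : h0 D ≠ 1) {p : C.Point}
    (hp : D p = 0) : ∃ (f : C.FunField) (hf : f ≠ 0),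
      0 ≤ principalDiv f hf + D - Finsupp.single p 1 := by
  rw [Ne, h0_eq_one_iff hD] at h
  push Not at h
  obtain ⟨f, hf, hc⟩ := h
  have hf0 : f ≠ 0 := fun h0 => hc 0 (by rw [h0, map_zero])
  -- Since `D p = 0`, the nonconstant section `f` is regular at `p`; subtracting its value there
  -- keeps it a nonzero section and makes it vanish at `p`.
  obtain ⟨c, h1⟩ := C.exists_sub_mem_maximalIdeal p (f := f) (by simpa [hp] using hf hf0 p)
  have hne : f - algebraMap k _ c ≠ 0 := fun h0 => hc c (sub_eq_zero.mp h0).symm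
  have hmem : f - algebraMap k _ c ∈ globalSections D := by
    refine sub_mem hf ?_
    rw [Algebra.algebraMap_eq_smul_one]
    exact Submodule.smul_mem _ c (one_mem_globalSections hD)
  refine ⟨_, hne, sub_single_nonneg (fun x => hmem hne x) ?_⟩
  rw [Finsupp.add_apply, hp, add_zero]
  exact h1 hne

/-- Otherwise `F + E - D` is the divisor of a section of `O(D)`, which is constant because `h⁰(D) =
1`. So `D = F + E ≥ E`, and the zero gcd forces `E = 0`, against `E > 0`. -/
theorem IsPresentation.not_linEquiv {L D E W F : C.Div} (h : IsPresentation L D E)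
    (hL : LinEquiv L (W - D + E)) (hF : 0 ≤ F) : ¬ LinEquiv L (W - F) := by
  rintro ⟨f, hf, hf'⟩
  obtain ⟨g, hg, hg'⟩ := hL
  have hord : ∀ x : C.Point, Scheme.ord (f * g⁻¹) x.1 = F x + E x - D x := fun x => by
    rw [Scheme.ord_mul hf (inv_ne_zero hg), ord_inv _ hg, hf', hg']
    simp only [Finsupp.add_apply, Finsupp.sub_apply]
    ring
  have hne := mul_ne_zero hf (inv_ne_zero hg)
  obtain ⟨c, hc⟩ := (h0_eq_one_iff h.effective).mp h.h0_eq_one (f * g⁻¹) fun _ x => by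
    rw [hord]
    linarith [show 0 ≤ F x from hF x, show 0 ≤ E x from h.pos.le x]
  have hc0 : c ≠ 0 := fun h0 => hne (by rw [← hc, h0, map_zero])
  refine h.pos.ne' (Finsupp.ext fun x => ?_)
  have h1 := hord x
  rw [← hc, ord_algebraMap_const hc0] at h1
  have h2 := DFunLike.congr_fun h.gcd_eq_zero x
  rw [Finsupp.inf_apply] at h2
  have h3 : 0 ≤ F x := hF x
  have h4 : 0 ≤ E x := h.pos.le x
  change E x = 0
  change D x ⊓ E x = 0 at h2
  rw [inf_of_le_right (by linarith)] at h2
  exact h2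

/-- If no effective divisor is linearly equivalent to `W - L`, then from effective divisors `D`, `E`
with `L ~ W - D + E` one gets a presentation of no larger degree. -/
theorem exists_isPresentation {L W : C.Div} (hW : IsCanonical W)
    (hL : ∀ F : C.Div, 0 ≤ F → ¬ LinEquiv L (W - F)) (N : ℕ) : ∀ {D E : C.Div}, 0 ≤ D → 0 ≤ E →
      LinEquiv L (W - D + E) → E.deg < N →
      ∃ D' E' : C.Div, IsPresentation L D' E' ∧ E'.deg ≤ E.deg := by
  induction N with
  | zero => exact fun _ hE _ hN => absurd hN (by simpa using Div.deg_nonneg hE)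
  | succ N ih =>
    intro D E hD hE h hN
    have hpos : ∀ {F : C.Div} {p : C.Point}, 0 ≤ F → F p ≠ 0 → 1 ≤ F p := fun {F p} hF hp =>
      lt_of_le_of_ne (show 0 ≤ F p from hF p) hp.symm
    -- Both reductions remove one point of `E`, so the induction on a strict bound for `deg E`
    -- applies.
    have descend : ∀ (D' : C.Div) (p : C.Point), E p ≠ 0 → 0 ≤ D' →
        LinEquiv L (W - D' + (E - Finsupp.single p 1)) →
        ∃ D' E' : C.Div, IsPresentation L D' E' ∧ E'.deg ≤ E.deg := fun D' p hp hD' h' => by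
      have hdeg : (E - Finsupp.single p 1).deg = E.deg - 1 := by
        rw [Div.deg_sub, Div.deg_single]
      obtain ⟨D₁, E₁, h₁, hle⟩ := ih hD' (sub_single_nonneg hE (hpos hE hp)) h' (by
        push_cast at hN; omega)
      exact ⟨D₁, E₁, h₁, by omega⟩
    by_cases hgcd : D ⊓ E = 0
    · have hE0 : E ≠ 0 := fun h0 => hL D hD (by rwa [h0, add_zero] at h)
      by_cases h1 : h0 D = 1
      · exact ⟨D, E, ⟨hD, h1, lt_of_le_of_ne hE hE0.symm, hgcd, W, hW, h⟩, le_rfl⟩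
      obtain ⟨p, hp : E p ≠ 0⟩ := Finsupp.ne_iff.mp hE0
      have hDp : D p = 0 := by
        have h2 : D p ⊓ E p = 0 := DFunLike.congr_fun hgcd p
        rcases min_choice (D p) (E p) with h3 | h3
        · rwa [← h3]
        · exact absurd (h3.symm.trans h2) hp
      -- `div f + D` is effective, equivalent to `D` and contains `p`, so `p` cancels against `E`.
      obtain ⟨f, hf, hD'⟩ := exists_section_vanishing hD h1 hDp
      refine descend _ p hp hD' (h.of_ord_eq hf fun x => ?_)
      simp only [Finsupp.add_apply, Finsupp.sub_apply, principalDiv_apply]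
      ring
    · obtain ⟨p, hp : D p ⊓ E p ≠ 0⟩ := Finsupp.ne_iff.mp hgcd
      have hDp : 0 ≤ D p := hD p
      have hEp : 0 ≤ E p := hE p
      refine descend (D - Finsupp.single p 1) p (fun h0 => hp (by rw [h0]; exact inf_of_le_right hDp))
        (sub_single_nonneg hD (hpos hD fun h0 => hp (by rw [h0]; exact inf_of_le_left hEp))) ?_
      convert h using 1
      abel

end SmoothCurve

/-! ### The exchange argument. -/

theorem proposition3p1 {k : Type u} [Field k] [IsAlgClosed k] [CharZero k]
    (C : SmoothCurve k) (n : ℕ) (φ : C.Covering n)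
    (L D E : C.Div) (h : SmoothCurve.IsMinimalPresentation L D E)
    (P Q : closedPoints (ProjLine k)) :
    (D ⊓ φ.pullback P).deg + (E ⊓ φ.pullback Q).deg ≤ (n : ℤ) := by
  obtain ⟨hpres, hmin⟩ := h
  obtain ⟨W, hW, hL⟩ := hpres.equiv
  by_contra! hlt
  obtain ⟨f, hf, hord⟩ := φ.linEquiv_pullback Q P
  -- The parts of `D` and `E` lying in the two fibres are traded for their residuals. The class
  -- changes by `φ^*P - φ^*Q`, which is principal.
  have hL' : SmoothCurve.LinEquiv L (W - (D - D ⊓ φ.pullback P + (φ.pullback Q - E ⊓ φ.pullback Q))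
      + (E - E ⊓ φ.pullback Q + (φ.pullback P - D ⊓ φ.pullback P))) :=
    hL.of_ord_eq hf fun x => by
      rw [hord]
      simp only [Finsupp.add_apply, Finsupp.sub_apply]
      ring
  have hE := add_nonneg (sub_nonneg.mpr (inf_le_left : E ⊓ φ.pullback Q ≤ E))
    (sub_nonneg.mpr (inf_le_right : D ⊓ φ.pullback P ≤ φ.pullback P))
  -- The exchanged pair may have common points or `h⁰ > 1`; the reduction repairs this without
  -- increasing the degree, and the original presentation supplies the non-effectivity of `W - L`.
  obtain ⟨D', E', h', hdeg⟩ := SmoothCurve.exists_isPresentation hW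
    (fun F hF => hpres.not_linEquiv hL hF) _
    (add_nonneg (sub_nonneg.mpr inf_le_left) (sub_nonneg.mpr inf_le_right)) hE hL'
    (Int.lt_add_one_of_le (Int.self_le_toNat _))
  have h1 := hmin D' E' h'
  rw [SmoothCurve.Div.deg_add, SmoothCurve.Div.deg_sub, SmoothCurve.Div.deg_sub] at hdeg
  linarith [φ.deg_pullback_le P]

end
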